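/- **Language.** Let $L^Q$ be the first-order language with constants $C_0,C_1,C_2$ (for $0,1,2$), relations $=,\le$, the six functions $x-y$ (truncated), $x\div y=\lfloor x/y\rfloor$ (with $x\div 0=0$), $\mathrm{Max}(x,y)$, $\mathrm{Root}(x,y)=\lfloor x^{1/y}\rfloor$ (and $0$ if $y=0$), $\mathrm{Log}(x)=\lfloor\log_2x\rfloor$ (with $\mathrm{Log}(0)=0$), $\mathrm{Count}(x,j)$ (the number of 1-bits among the $j$ rightmost bits of $x$), and a unary function symbol $\theta$. Put $\mathrm{Half}(x)=x\div 2$, $\mathrm{Pred}(x)=x-1$ and $\mathrm{Power}(x):\ x=1\vee \mathrm{Log}(x)\ne\mathrm{Log}(x-1)$. For $j\ge1$ let $E_j$ be the closed term $M\div\mathrm{Half}^j(M)$ with $M=\mathrm{Max}[\theta^j(1),\dots,\theta(1)]$, which denotes $2^j$. Each $n\in\mathbb N$ has a numeral $T_n$ built from the constants, the terms $E_j$ and subtraction. A $\Delta_0^Q$ formula has only bounded quantifiers and only terms built from variables, $C_0,C_1,C_2$ and the $E_j$ ($j\ge2$) by the six functions (so $\theta$ occurs only inside terms $E_j$); a $\Pi_1^Q$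 sentence is $\forall v_1\cdots\forall v_k\,\phi$ with $\phi$ a $\Delta_0^Q$ formula; it is simple if no $E_j$ with $j\ge 2$ occurs. Truth refers to the standard model $\mathbb N$ (for $\Delta_0^Q$ and $\Pi_1^Q$ sentences it does not depend on which $\theta$ satisfying the Group-0 axioms below is used). **Deduction.** Proofs use modus ponens only, with as logical axioms all generalizations $\forall x_1\cdots\forall x_m\,\lambda$ of instances $\lambda$ of $B\Rightarrow(C\Rightarrow B)$; $[B\Rightarrow(C\Rightarrow D)]\Rightarrow[(B\Rightarrow C)\Rightarrow(B\Rightarrow D)]$; $(\neg C\Rightarrow\neg B)\Rightarrow[(\neg C\Rightarrow B)\Rightarrow C]$; $\forall x\,\phi\Rightarrow\phi(t)$ ($t$ substitutable for $x$); $\forall x(\phi\Rightarrow\psi)\Rightarrow(\forall x\phi\Rightarrow\forall x\psi)$; $\psi\Rightarrow\forall x\psi$ ($x$ not free in $\psi$). Here $\wedge,\vee,\exists$ are the usual abbreviations. Formulas $\Phi$ and proofs have Gödel numbers $\ulcorner\Phi\urcorner$: every symbol is one 6-bit byte with value in $\{32,\dots,63\}$, the $j$-th variable is one such byte followed by the base-32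 digits of $j$, each formula in a proof is ended by a period, and the byte string is read in base 64. **Axiom groups.** *Group 0:* $\mathrm{Pred}(C_0)=C_0\wedge C_1\ne C_0\wedge \mathrm{Pred}(C_1)=C_0\wedge\mathrm{Pred}(C_2)=C_1\wedge\forall x\,\neg(C_0<x<C_1)$; $\forall x(\mathrm{Power}(x)\Rightarrow\mathrm{Power}(\theta(x)))$; $\forall x\;\theta(x)\ne1$; $\forall x\forall y([x\ne y\wedge\mathrm{Power}(x)]\Rightarrow\theta(x)\ne\theta(y))$; $\forall x(\neg\mathrm{Power}(x)\Rightarrow\theta(x)=0)$; $\forall x([\mathrm{Power}(x)\wedge x\ge2]\Rightarrow x\div\mathrm{Half}(x)=2)$. *Group 1:* a fixed finite set $S$ of simple $\Pi_1^Q$ sentences, consistent with Group 0, such that Group 0 and $S$ together prove every true $\Delta_0^Q$ sentence, the reflexivity, symmetry and transitivity of $=$, and that $\le$ is a total order. *Group 2* (for a system $\beta$ of axioms in $L^Q$): for every $\Pi_1^Q$ sentence $\Phi$ the ($\Pi_1^Q$) axiom $\forall y\{\mathrm{HilbPrf}_\beta(\ulcorner\Phi\urcorner,y)\Rightarrow\Phi\}$,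 where $\mathrm{HilbPrf}_\beta(x,y)$ is a $\Delta_0^Q$ formula expressing that $y$ is a proof from $\beta$ of the formula $x$. *Group 3:* let $U$ be the union of Groups 0, 1, 2, and let $$\Gamma(g)=\forall p\,\neg\bigl(\mathrm{Prf}_U(\ulcorner0=1\urcorner,p)\vee\exists h\le p\,[\mathrm{Subst}(g,h)\wedge\mathrm{ExPrf}_U(h,\ulcorner0=1\urcorner,p)]\bigr),$$ where $\mathrm{Prf}_U(t,p)$, $\mathrm{ExPrf}_U(h,t,p)$ and $\mathrm{Subst}(g,h)$ are $\Delta_0^Q$ formulas expressing, respectively, that $p$ is a proof of $t$ from $U$, that $p$ is a proof of $t$ from $U$ and the added axiom $h$, and that $h$ is the sentence obtained from the formula $g$ by substituting the numeral $T_g$ for its free variables. The Group-3 axiom is $\Gamma(T_n)$ with $n=\ulcorner\Gamma(g)\urcorner$; it says "there is no proof of $0=1$ from $U$ and this sentence". $\mathrm{IQFS}(\beta)$ is $U$ together with the Group-3 axiom. **Conjecture.** A $\Pi_1^Q$ sentence $\forall x\,\phi(x)$ is a *Size-$K$ breaking point* if $\phi(K)$ is false and $\phi(x)$ is true for all $x<K$.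 The conjecture states: if $\gamma$ consists of the Group-0 and Group-1 axioms, a set of true $\Pi_1^Q$ sentences, and one $\Pi_1^Q$ sentence $\Psi$ that is a Size-$K$ breaking point with $K>2$, then every Gödel number $P$ of a proof of $0=1$ from $\gamma$ satisfies $\log_2K<\tfrac16\log_2P$. **Theorem 1.** If the conjecture holds, then $\mathrm{IQFS}(\cdot)$ is consistency preserving: for every system $\beta$ of axioms in $L^Q$ whose union with the Group-0 and Group-1 axioms is consistent, $\mathrm{IQFS}(\beta)$ is consistent (for every choice of the $\Delta_0^Q$ formulas above). -/

import Mathlib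

namespace IQFS

/-! ### The language `L^Q`

Mathlib's first-order syntax has neither named variables nor a proof calculus, and proofs have to be
written as byte strings here, so the syntax is concrete: variables are named by natural numbers. -/

/-- Terms of the Q-Grounding language: variables, the constants `C₀, C₁, C₂` (for 0, 1, 2), the six
non-growth functions, and the function symbol `θ`. -/
inductive Term : Type
  | var : ℕ → Term
  | c0 : Term
  | c1 : Term
  | c2 : Term
  | sub : Term → Term → Term
  | div : Term → Term → Term
  | max : Term → Term → Term
  | root : Term → Term → Term
  | log : Term → Term
  | count : Term → Term → Term
  | theta : Term → Term

/-- Formulas of the Q-Grounding language. `∧`, `∨`, `∃` may be written, but for the deductive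
apparatus they are the usual abbreviations, see `Formula.core`. -/
inductive Formula : Type
  | eq : Term → Term → Formula
  | le : Term → Term → Formula
  | neg : Formula → Formula
  | imp : Formula → Formula → Formula
  | and : Formula → Formula → Formula
  | or : Formula → Formula → Formula
  | all : ℕ → Formula → Formula
  | ex : ℕ → Formula → Formula

/-- The variables of a term. -/
def Term.vars : Term → Finset ℕ
  | .var n => {n}
  | .c0 => ∅
  | .c1 => ∅
  | .c2 => ∅
  | .sub s t => s.vars ∪ t.vars
  | .div s t => s.vars ∪ t.vars
  | .max s t => s.vars ∪ t.vars
  | .root s t => s.vars ∪ t.vars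
  | .log s => s.vars
  | .count s t => s.vars ∪ t.vars
  | .theta s => s.vars

/-- `t.subst x r`: replace the variable `x` by the term `r` in the term `t`. -/
def Term.subst : Term → ℕ → Term → Term
  | .var n, x, r => if n = x then r else .var n
  | .c0, _, _ => .c0
  | .c1, _, _ => .c1
  | .c2, _, _ => .c2
  | .sub s t, x, r => .sub (s.subst x r) (t.subst x r)
  | .div s t, x, r => .div (s.subst x r) (t.subst x r)
  | .max s t, x, r => .max (s.subst x r) (t.subst x r)
  | .root s t, x, r => .root (s.subst x r) (t.subst x r)
  | .log s, x, r => .log (s.subst x r)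
  | .count s t, x, r => .count (s.subst x r) (t.subst x r)
  | .theta s, x, r => .theta (s.subst x r)

/-- `t.close B r`: replace every variable outside `B` by the term `r` in the term `t`. -/
def Term.close : Term → Finset ℕ → Term → Term
  | .var n, B, r => if n ∈ B then .var n else r
  | .c0, _, _ => .c0
  | .c1, _, _ => .c1
  | .c2, _, _ => .c2
  | .sub s t, B, r => .sub (s.close B r) (t.close B r)
  | .div s t, B, r => .div (s.close B r) (t.close B r)
  | .max s t, B, r => .max (s.close B r) (t.close B r)
  | .root s t, B, r => .root (s.close B r) (t.close B r)
  | .log s, B, r => .log (s.close B r)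
  | .count s t, B, r => .count (s.close B r) (t.close B r)
  | .theta s, B, r => .theta (s.close B r)

namespace Formula

/-- All variables (free or bound) that occur in a formula. -/
def vars : Formula → Finset ℕ
  | eq s t => s.vars ∪ t.vars
  | le s t => s.vars ∪ t.vars
  | neg φ => φ.vars
  | imp φ ψ => φ.vars ∪ ψ.vars
  | and φ ψ => φ.vars ∪ ψ.vars
  | or φ ψ => φ.vars ∪ ψ.vars
  | all x φ => insert x φ.vars
  | ex x φ => insert x φ.vars

/-- The free variables of a formula. -/
def fv : Formula → Finset ℕ
  | eq s t => s.vars ∪ t.vars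
  | le s t => s.vars ∪ t.vars
  | neg φ => φ.fv
  | imp φ ψ => φ.fv ∪ ψ.fv
  | and φ ψ => φ.fv ∪ ψ.fv
  | or φ ψ => φ.fv ∪ ψ.fv
  | all x φ => φ.fv.erase x
  | ex x φ => φ.fv.erase x

/-- A sentence is a formula without free variables. -/
def IsSentence (φ : Formula) : Prop := φ.fv = ∅

/-- Replace the free occurrences of the variable `x` by the term `r`. -/
def subst (x : ℕ) (r : Term) : Formula → Formula
  | eq s t => eq (s.subst x r) (t.subst x r)
  | le s t => le (s.subst x r) (t.subst x r)
  | neg φ => neg (φ.subst x r)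
  | imp φ ψ => imp (φ.subst x r) (ψ.subst x r)
  | and φ ψ => and (φ.subst x r) (ψ.subst x r)
  | or φ ψ => or (φ.subst x r) (ψ.subst x r)
  | all y φ => if y = x then all y φ else all y (φ.subst x r)
  | ex y φ => if y = x then ex y φ else ex y (φ.subst x r)

/-- The term `r` is substitutable for the variable `x` (no variable of `r` gets captured). -/
def Substitutable (x : ℕ) (r : Term) : Formula → Prop
  | eq _ _ => True
  | le _ _ => True
  | neg φ => φ.Substitutable x r
  | imp φ ψ => φ.Substitutable x r ∧ ψ.Substitutable x r
  | and φ ψ => φ.Substitutable x r ∧ ψ.Substitutable x r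
  | or φ ψ => φ.Substitutable x r ∧ ψ.Substitutable x r
  | all y φ => x ∉ φ.fv.erase y ∨ (y ∉ r.vars ∧ φ.Substitutable x r)
  | ex y φ => x ∉ φ.fv.erase y ∨ (y ∉ r.vars ∧ φ.Substitutable x r)

/-- Replace by `r` the occurrences of variables that are neither in `B` nor bound. -/
def closeAux : Formula → Finset ℕ → Term → Formula
  | eq s t, B, r => eq (s.close B r) (t.close B r)
  | le s t, B, r => le (s.close B r) (t.close B r)
  | neg φ, B, r => neg (φ.closeAux B r)
  | imp φ ψ, B, r => imp (φ.closeAux B r) (ψ.closeAux B r)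
  | and φ ψ, B, r => and (φ.closeAux B r) (ψ.closeAux B r)
  | or φ ψ, B, r => or (φ.closeAux B r) (ψ.closeAux B r)
  | all y φ, B, r => all y (φ.closeAux (insert y B) r)
  | ex y φ, B, r => ex y (φ.closeAux (insert y B) r)

/-- Replace every free occurrence of every variable by the (closed) term `r`. -/
def close (φ : Formula) (r : Term) : Formula := φ.closeAux ∅ r

/-- Write out the abbreviations `∧`, `∨`, `∃` through `¬`, `⇒`, `∀`. -/
def core : Formula → Formula
  | eq s t => eq s t
  | le s t => le s t
  | neg φ => neg φ.core
  | imp φ ψ => imp φ.core ψ.core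
  | and φ ψ => neg (imp φ.core (neg ψ.core))
  | or φ ψ => imp (neg φ.core) ψ.core
  | all x φ => all x φ.core
  | ex x φ => neg (all x (neg φ.core))

/-- `∀ x₁ … ∀ xₖ φ`. -/
def allList (xs : List ℕ) (φ : Formula) : Formula := xs.foldr all φ

/-- `s < t`. -/
def lt (s t : Term) : Formula := and (le s t) (neg (eq s t))

end Formula

open Term Formula

/-! ### The terms `E_j` and the numerals `T_n` -/

/-- The predecessor `t - 1`. -/
def pred (t : Term) : Term := sub t c1

/-- `Half(t) = t ÷ 2`. -/
def half (t : Term) : Term := div t c2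

/-- `θ^j(1)`. -/
def thetaPow : ℕ → Term
  | 0 => c1
  | j + 1 => theta (thetaPow j)

/-- `thetaMax j = Max[θ^{j+1}(1), θ^j(1), …, θ(1)]`. -/
def thetaMax : ℕ → Term
  | 0 => theta c1
  | j + 1 => Term.max (thetaPow (j + 2)) (thetaMax j)

/-- The term `E_j` whose value is `2^j`: for `j ≥ 1` it is `M / Half^j(M)` with
`M = Max[θ^j(1), …, θ(1)]`, and `E_0` is `C₁`. -/
def E : ℕ → Term
  | 0 => c1
  | j + 1 => div (thetaMax j) (half^[j + 1] (thetaMax j))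

/-- The constant or `E`-term that denotes `2^j`. -/
def powTerm : ℕ → Term
  | 0 => c1
  | 1 => c2
  | j + 2 => E (j + 2)

/-- The numeral `T_n`: the least power of two that is `≥ n`, minus the powers of two that are
needed to come down to `n`, the largest first (`T_76 = E_7 - E_5 - E_4 - E_2`). -/
def num (n : ℕ) : Term :=
  if n = 0 then c0
  else ((List.range (Nat.clog 2 n)).reverse.filter
      fun i => (2 ^ Nat.clog 2 n - n).testBit i).foldl
    (fun t i => sub t (powTerm i)) (powTerm (Nat.clog 2 n))

/-! ### The standard model -/

/-- `⌊x^{1/y}⌋` for `y ≥ 1`, and `0` for `y = 0`. -/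
def rootFn (x y : ℕ) : ℕ := if y = 0 then 0 else Nat.findGreatest (fun r => r ^ y ≤ x) x

/-- The number of `1` bits among the `j` rightmost bits of `x`. -/
def countFn (x j : ℕ) : ℕ := ((Finset.range j).filter fun i => x.testBit i = true).card

/-- An interpretation of `θ` that obeys the Up-Walking axioms. The formulas whose truth is spoken of
below contain `θ` only inside terms `E_j`, and `E_j` has the value `2^j` for every interpretation of
`θ` that obeys these axioms. -/
def thetaFn (x : ℕ) : ℕ := if 2 ^ Nat.log 2 x = x then 2 * x else 0

/-- The value of a term in the standard model; `-` is truncated, `x ÷ 0 = 0`, `Log 0 = 0`. -/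
def Term.eval (v : ℕ → ℕ) : Term → ℕ
  | .var n => v n
  | .c0 => 0
  | .c1 => 1
  | .c2 => 2
  | .sub s t => s.eval v - t.eval v
  | .div s t => s.eval v / t.eval v
  | .max s t => Nat.max (s.eval v) (t.eval v)
  | .root s t => rootFn (s.eval v) (t.eval v)
  | .log s => Nat.log 2 (s.eval v)
  | .count s t => countFn (s.eval v) (t.eval v)
  | .theta s => thetaFn (s.eval v)

/-- Truth of a formula in the standard model under an assignment of the variables. -/
def Formula.Sat : (ℕ → ℕ) → Formula → Prop
  | v, .eq s t => s.eval v = t.eval v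
  | v, .le s t => s.eval v ≤ t.eval v
  | v, .neg φ => ¬ Formula.Sat v φ
  | v, .imp φ ψ => Formula.Sat v φ → Formula.Sat v ψ
  | v, .and φ ψ => Formula.Sat v φ ∧ Formula.Sat v ψ
  | v, .or φ ψ => Formula.Sat v φ ∨ Formula.Sat v ψ
  | v, .all x φ => ∀ a, Formula.Sat (Function.update v x a) φ
  | v, .ex x φ => ∃ a, Formula.Sat (Function.update v x a) φ

/-- Truth in the standard model. -/
def IsTrue (φ : Formula) : Prop := ∀ v, φ.Sat v

/-! ### `Δ₀^Q` and `Π₁^Q` formulas -/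

/-- The terms built from variables and the closed terms in `C` by the six non-growth functions. -/
inductive IsTermOver (C : Set Term) : Term → Prop
  | var (n : ℕ) : IsTermOver C (.var n)
  | const {t : Term} : t ∈ C → IsTermOver C t
  | sub {s t : Term} : IsTermOver C s → IsTermOver C t → IsTermOver C (.sub s t)
  | div {s t : Term} : IsTermOver C s → IsTermOver C t → IsTermOver C (.div s t)
  | max {s t : Term} : IsTermOver C s → IsTermOver C t → IsTermOver C (.max s t)
  | root {s t : Term} : IsTermOver C s → IsTermOver C t → IsTermOver C (.root s t)
  | log {s : Term} : IsTermOver C s → IsTermOver C (.log s)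
  | count {s t : Term} : IsTermOver C s → IsTermOver C t → IsTermOver C (.count s t)

/-- Formulas over such terms all of whose quantifiers are bounded: `∀ x ≤ t φ` or `∃ x ≤ t φ`. -/
inductive IsDelta0Over (C : Set Term) : Formula → Prop
  | eq {s t : Term} : IsTermOver C s → IsTermOver C t → IsDelta0Over C (.eq s t)
  | le {s t : Term} : IsTermOver C s → IsTermOver C t → IsDelta0Over C (.le s t)
  | neg {φ : Formula} : IsDelta0Over C φ → IsDelta0Over C (.neg φ)
  | imp {φ ψ : Formula} : IsDelta0Over C φ → IsDelta0Over C ψ → IsDelta0Over C (.imp φ ψ)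
  | and {φ ψ : Formula} : IsDelta0Over C φ → IsDelta0Over C ψ → IsDelta0Over C (.and φ ψ)
  | or {φ ψ : Formula} : IsDelta0Over C φ → IsDelta0Over C ψ → IsDelta0Over C (.or φ ψ)
  | ball {x : ℕ} {t : Term} {φ : Formula} : IsTermOver C t → x ∉ t.vars → IsDelta0Over C φ →
      IsDelta0Over C (.all x (.imp (.le (.var x) t) φ))
  | bex {x : ℕ} {t : Term} {φ : Formula} : IsTermOver C t → x ∉ t.vars → IsDelta0Over C φ →
      IsDelta0Over C (.ex x (.and (.le (.var x) t) φ))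

/-- The three built-in constants. -/
def baseConsts : Set Term := {c0, c1, c2}

/-- The three built-in constants and the terms `E_j`, `j ≥ 2`, which stand for the further constants
`C_{j+1} = 2^j` of the language with additive naming. -/
def qConsts : Set Term := baseConsts ∪ {t | ∃ j, 2 ≤ j ∧ t = E j}

/-- `Δ₀^Q` formulas. -/
def IsDelta0Q (φ : Formula) : Prop := IsDelta0Over qConsts φ

/-- `Π₁^Q` sentences `∀ x₁ … ∀ xₖ φ`, with `φ` a `Δ₀^Q` formula. -/
def IsPi1Q (Φ : Formula) : Prop :=
  Φ.IsSentence ∧ ∃ xs φ, IsDelta0Q φ ∧ Φ = allList xs φ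

/-- Simple `Π₁^Q` sentences: no `E_j` with `j ≥ 2` occurs. -/
def IsSimplePi1Q (Φ : Formula) : Prop :=
  Φ.IsSentence ∧ ∃ xs φ, IsDelta0Over baseConsts φ ∧ Φ = allList xs φ

/-! ### The deductive apparatus -/

/-- The logical axioms, for formulas in which the abbreviations are written out: Mendelson's three
propositional schemas, Enderton's quantifier schemas, and all generalizations of these. -/
inductive LogicalAxiom : Formula → Prop
  | one (B C : Formula) : LogicalAxiom (.imp B (.imp C B))
  | two (B C D : Formula) :
      LogicalAxiom (.imp (.imp B (.imp C D)) (.imp (.imp B C) (.imp B D)))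
  | three (B C : Formula) :
      LogicalAxiom (.imp (.imp (.neg C) (.neg B)) (.imp (.imp (.neg C) B) C))
  | inst (x : ℕ) (t : Term) (φ : Formula) (h : φ.Substitutable x t) :
      LogicalAxiom (.imp (.all x φ) (φ.subst x t))
  | dist (x : ℕ) (φ ψ : Formula) :
      LogicalAxiom (.imp (.all x (.imp φ ψ)) (.imp (.all x φ) (.all x ψ)))
  | vac (x : ℕ) (φ : Formula) (h : x ∉ φ.fv) : LogicalAxiom (.imp φ (.all x φ))
  | gen (x : ℕ) {φ : Formula} : LogicalAxiom φ → LogicalAxiom (.all x φ)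

/-- The line `φ` is justified after the lines `l`: it is a proper axiom, or a logical axiom, or
follows from two earlier lines by modus ponens. -/
def Justified (α : Set Formula) (l : List Formula) (φ : Formula) : Prop :=
  φ ∈ α ∨ LogicalAxiom φ.core ∨
    ∃ ψ ∈ l, ∃ χ ∈ l, χ.core = .imp ψ.core φ.core

/-- The sequences of formulas each of which is justified by the preceding ones. -/
inductive IsDerivation (α : Set Formula) : List Formula → Prop
  | nil : IsDerivation α []
  | snoc {l : List Formula} {φ : Formula} :
      IsDerivation α l → Justified α l φ → IsDerivation α (l ++ [φ])

/-- `l` is a proof of `φ` from the proper axioms `α`. -/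
def IsProof (α : Set Formula) (φ : Formula) (l : List Formula) : Prop :=
  IsDerivation α l ∧ l.getLast? = some φ

/-- `φ` is a theorem of `α`. -/
def Provable (α : Set Formula) (φ : Formula) : Prop := ∃ l, IsProof α φ l

/-- No formula is provable together with its negation. -/
def Consistent (α : Set Formula) : Prop := ¬ ∃ φ, Provable α φ ∧ Provable α (.neg φ)

/-- The formula `0 = 1`. -/
def zeroEqOne : Formula := .eq c0 c1

/-! ### Gödel numbers

Each of the 23 symbols is a byte between 32 and 63; a variable is the byte of the symbol `V`
followed by its index in base 32; a byte string is read as a number in base 64. -/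

/-- A variable: the symbol `V` and the base-32 digits of the index, most significant first. -/
def varBytes (n : ℕ) : List ℕ := 51 :: (Nat.digits 32 n).reverse

/-- `f(s)` with function symbol `f`. Here 38 is `(` and 39 is `)`. -/
def app1 (f : ℕ) (s : List ℕ) : List ℕ := [f, 38] ++ s ++ [39]

/-- `f(s,t)` with function symbol `f`. Here 40 is the comma. -/
def app2 (f : ℕ) (s t : List ℕ) : List ℕ := [f, 38] ++ s ++ [40] ++ t ++ [39]

/-- The byte string of a term. -/
def Term.bytes : Term → List ℕ
  | .var n => varBytes n
  | .c0 => [52]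
  | .c1 => [53]
  | .c2 => [54]
  | .sub s t => app2 42 s.bytes t.bytes
  | .div s t => app2 43 s.bytes t.bytes
  | .max s t => app2 44 s.bytes t.bytes
  | .root s t => app2 45 s.bytes t.bytes
  | .log s => app1 46 s.bytes
  | .count s t => app2 47 s.bytes t.bytes
  | .theta s => app1 48 s.bytes

/-- The byte string of a formula. -/
def Formula.bytes : Formula → List ℕ
  | .eq s t => s.bytes ++ [49] ++ t.bytes
  | .le s t => s.bytes ++ [50] ++ t.bytes
  | .neg φ => 34 :: φ.bytes
  | .imp φ ψ => [38] ++ φ.bytes ++ [35] ++ ψ.bytes ++ [39]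
  | .and φ ψ => [38] ++ φ.bytes ++ [32] ++ ψ.bytes ++ [39]
  | .or φ ψ => [38] ++ φ.bytes ++ [33] ++ ψ.bytes ++ [39]
  | .all x φ => 36 :: (varBytes x ++ φ.bytes)
  | .ex x φ => 37 :: (varBytes x ++ φ.bytes)

/-- The number that a byte string denotes in base 64, most significant byte first. -/
def bytesToNat (l : List ℕ) : ℕ := Nat.ofDigits 64 l.reverse

/-- The Gödel number of a formula. -/
def Formula.code (φ : Formula) : ℕ := bytesToNat φ.bytes

/-- The Gödel number of a sequence of formulas; each is ended by a period (the byte 41). -/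
def proofCode (l : List Formula) : ℕ := bytesToNat (l.flatMap fun φ => φ.bytes ++ [41])

/-- `p` is the Gödel number of a proof of `φ` from `α`. -/
def IsProofCode (α : Set Formula) (φ : Formula) (p : ℕ) : Prop :=
  ∃ l, IsProof α φ l ∧ proofCode l = p

/-! ### Groups 0 and 1 -/

/-- `Power(t)`: `t` is a power of two. -/
def powerF (t : Term) : Formula := .or (.eq t c1) (.neg (.eq (log t) (log (pred t))))

/-- The axiom for the constants `C₀, C₁, C₂`. -/
def startAxiom : Formula :=
  .and (.eq (pred c0) c0) <| .and (.neg (.eq c1 c0)) <| .and (.eq (pred c1) c0) <|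
    .and (.eq (pred c2) c1) <| .all 0 (.neg (.and (lt c0 (var 0)) (lt (var 0) c1)))

/-- `∀ x, Power(x) ⇒ Power(θ(x))`. -/
def walk1 : Formula := .all 0 (.imp (powerF (var 0)) (powerF (theta (var 0))))

/-- `∀ x, θ(x) ≠ 1`. -/
def walk2 : Formula := .all 0 (.neg (.eq (theta (var 0)) c1))

/-- `∀ x ∀ y, [x ≠ y ∧ Power(x)] ⇒ θ(x) ≠ θ(y)`. -/
def walk3 : Formula :=
  .all 0 (.all 1 (.imp (.and (.neg (.eq (var 0) (var 1))) (powerF (var 0)))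
    (.neg (.eq (theta (var 0)) (theta (var 1))))))

/-- `∀ x, ¬ Power(x) ⇒ θ(x) = 0`. -/
def walk4 : Formula := .all 0 (.imp (.neg (powerF (var 0))) (.eq (theta (var 0)) c0))

/-- `∀ x, [Power(x) ∧ x ≥ 2] ⇒ x / Half(x) = 2`. -/
def halfAxiom : Formula :=
  .all 0 (.imp (.and (powerF (var 0)) (.le c2 (var 0))) (.eq (div (var 0) (half (var 0))) c2))

/-- The Group-Zero axioms. -/
def group0 : Set Formula := {startAxiom, walk1, walk2, walk3, walk4, halfAxiom}

/-- Equality is reflexive, symmetric and transitive, and `≤` is a total order. -/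
def orderProperties : Set Formula :=
  { .all 0 (.eq (var 0) (var 0)),
    .all 0 (.all 1 (.imp (.eq (var 0) (var 1)) (.eq (var 1) (var 0)))),
    .all 0 (.all 1 (.all 2 (.imp (.and (.eq (var 0) (var 1)) (.eq (var 1) (var 2)))
      (.eq (var 0) (var 2))))),
    .all 0 (.le (var 0) (var 0)),
    .all 0 (.all 1 (.imp (.and (.le (var 0) (var 1)) (.le (var 1) (var 0)))
      (.eq (var 0) (var 1)))),
    .all 0 (.all 1 (.all 2 (.imp (.and (.le (var 0) (var 1)) (.le (var 1) (var 2)))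
      (.le (var 0) (var 2))))),
    .all 0 (.all 1 (.or (.le (var 0) (var 1)) (.le (var 1) (var 0)))) }

/-- `S` may serve as the Group-1 scheme: a finite set of simple `Π₁^Q` sentences that is consistent
with Group-Zero and together with it proves every true `Δ₀^Q` sentence and the usual properties of
equality and order. -/
def IsGroup1 (S : Set Formula) : Prop :=
  S.Finite ∧ (∀ Φ ∈ S, IsSimplePi1Q Φ) ∧ Consistent (group0 ∪ S) ∧
    (∀ φ, IsDelta0Q φ → φ.IsSentence → IsTrue φ → Provable (group0 ∪ S) φ) ∧
    ∀ φ ∈ orderProperties, Provable (group0 ∪ S) φ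

/-! ### Groups 2 and 3

The arithmetized predicates are arbitrary `Δ₀^Q` formulas that express the predicate in question in
the standard model. Such a formula need not even be correct at arguments that are not Gödel numbers
of formulas. -/

/-- `F` is a `Δ₀^Q` formula, with free variables `x, y`, expressing that `y` is the Gödel number of
a proof from `α` of the formula with Gödel number `x`. -/
def ExpressesPrf (α : Set Formula) (x y : ℕ) (F : Formula) : Prop :=
  IsDelta0Q F ∧ F.fv ⊆ {x, y} ∧
    ∀ (v : ℕ → ℕ) (φ : Formula), v x = φ.code → (F.Sat v ↔ IsProofCode α φ (v y))

/-- `F` is a `Δ₀^Q` formula, with free variables `x, y, z`, expressing that `z` is the Gödel number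
of a proof of the formula with Gödel number `y` from `α` together with the added axiom with Gödel
number `x`. -/
def ExpressesExPrf (α : Set Formula) (x y z : ℕ) (F : Formula) : Prop :=
  IsDelta0Q F ∧ F.fv ⊆ {x, y, z} ∧
    ∀ (v : ℕ → ℕ) (ψ φ : Formula), v x = ψ.code → v y = φ.code →
      (F.Sat v ↔ IsProofCode (α ∪ {ψ}) φ (v z))

/-- `F` is a `Δ₀^Q` formula, with free variables `x, y`, expressing that `y` is the Gödel number of
the sentence obtained from the formula with Gödel number `x` by replacing all free occurrences of
variables by the numeral for `x`. -/
def ExpressesSubst (x y : ℕ) (F : Formula) : Prop :=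
  IsDelta0Q F ∧ F.fv ⊆ {x, y} ∧
    ∀ (v : ℕ → ℕ) (φ : Formula), v x = φ.code →
      (F.Sat v ↔ v y = (φ.close (num (v x))).code)

/-- The Group-2 axiom `∀ y {HilbPrf(⌜Φ⌝, y) ⇒ Φ}` for `Φ = ∀ x₁ … ∀ xₖ φ`, in its prenex `Π₁^Q` form
`∀ y ∀ x₁ … ∀ xₖ {HilbPrf(⌜Φ⌝, y) ⇒ φ}`. Here `H` is `HilbPrf`, with free variables `0, 1`, and `y`
is a fresh variable. -/
def group2Axiom (H : Formula) (xs : List ℕ) (φ : Formula) : Formula :=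
  let y := (H.vars ∪ (allList xs φ).vars).sup id + 1
  .all y (allList xs (.imp ((H.subst 0 (num (allList xs φ).code)).subst 1 (var y)) φ))

/-- The Group-2 scheme: one axiom for each `Π₁^Q` sentence. -/
def group2 (H : Formula) : Set Formula :=
  {χ | ∃ xs φ, IsDelta0Q φ ∧ (allList xs φ).IsSentence ∧ χ = group2Axiom H xs φ}

/-- The union of the Groups 0, 1 and 2. -/
def unionAxioms (S : Set Formula) (H : Formula) : Set Formula := group0 ∪ S ∪ group2 H

/-- The formula `Γ(g) = ∀ p ¬ SubstPrf(g, ⌜0=1⌝, p)`, where `SubstPrf(g, t, p)` is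
`Prf(t, p) ∨ ∃ h ≤ p [Subst(g, h) ∧ ExPrf(h, t, p)]`. The variables `g, t, p, h` are `0, 1, 2, 3`;
`A`, `X` and `D` are `Prf`, `ExPrf` and `Subst`. -/
def gammaF (A X D : Formula) : Formula :=
  .all 2 (.neg ((Formula.or A
    (.ex 3 (.and (.le (var 3) (var 2)) (.and D X)))).subst 1 (num zeroEqOne.code)))

/-- The Group-3 sentence `Γ(n)`, where `n` is the Gödel number of `Γ(g)`. -/
def group3 (A X D : Formula) : Formula :=
  (gammaF A X D).close (num (gammaF A X D).code)

/-- `T` is the system `IQFS(β)` with Group-1 scheme `S` (for some choice of the `Δ₀^Q` formulas that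
arithmetize the proof predicates and substitution). -/
def IsIQFS (S β T : Set Formula) : Prop :=
  ∃ H A X D : Formula,
    ExpressesPrf β 0 1 H ∧
    ExpressesPrf (unionAxioms S H) 1 2 A ∧
    ExpressesExPrf (unionAxioms S H) 3 1 2 X ∧
    ExpressesSubst 0 3 D ∧
    T = unionAxioms S H ∪ {group3 A X D}

/-- `IQFS(·)` with Group-1 scheme `S` is consistency preserving: `IQFS(β)` is consistent whenever
the union of `β` with the Groups 0 and 1 is consistent. -/
def ConsistencyPreserving (S : Set Formula) : Prop :=
  ∀ β : Set Formula, Consistent (β ∪ (group0 ∪ S)) → ∀ T, IsIQFS S β T → Consistent T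

/-! ### The conjecture -/

/-- The sentence `Ψ`, of the form `∀ x φ(x)`, is a Size-`K` breaking point: `φ(K)` is false and
`φ(x)` is true for all `x < K`. -/
def IsBreakingPoint (Ψ : Formula) (K : ℕ) : Prop :=
  IsPi1Q Ψ ∧ ∃ x φ, Ψ = .all x φ ∧
    ¬ φ.Sat (Function.update (fun _ => 0) x K) ∧
    ∀ k < K, φ.Sat (Function.update (fun _ => 0) x k)

/-- The conjecture: if the axioms of `γ` are those of the Groups 0 and 1, a set `B` of true `Π₁^Q`
sentences, and a `Π₁^Q` sentence `Ψ` that is a Size-`K` breaking point with `K > 2`, then every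
Gödel number `P` of a proof of `0 = 1` from `γ` satisfies `log₂ K < (1/6) log₂ P`. -/
def BreakingPointConjecture (S : Set Formula) : Prop :=
  ∀ (B : Set Formula) (Ψ : Formula) (K P : ℕ),
    (∀ Φ ∈ B, IsPi1Q Φ ∧ IsTrue Φ) → IsBreakingPoint Ψ K → 2 < K →
    IsProofCode (group0 ∪ S ∪ B ∪ {Ψ}) zeroEqOne P →
    Real.logb 2 K < 1 / 6 * Real.logb 2 P

end IQFS

/-!
Let `U` be the union of the Groups 0, 1 and 2. Two facts make `U` true in the standard model. The
Group-0 axioms are checked directly. A false `Π₁^Q` sentence has an instance at numerals that is a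
false `Δ₀^Q` sentence, and its negation is provable from the Groups 0 and 1; hence a theory that is
consistent with these groups proves no false `Π₁^Q` sentence (`isTrue_of_provable`). Applied to the
Groups 0 and 1 themselves this gives the truth of Group 1, and applied to `β` it gives the truth of
the reflection axioms of Group 2.

If `IQFS(β)` is inconsistent, let `K` be the least Gödel number of a proof of `0 = 1` from it. As
`U` is true, this proof contains the Group-3 sentence, so the Gödel number of that sentence is at
most `K`, and the matrix of the Group-3 sentence fails at `K`. It holds below `K`, because a failure
at `k` is a proof of `0 = 1` with Gödel number `k`. Hence the Group-3 sentence is a Size-`K` breaking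
point, and the proof whose existence makes it one is itself a proof from that sentence, the Groups
0 and 1, and the true `Π₁^Q` sentences of Group 2. The conjecture, applied with `P = K`, yields
`log₂ K < (1/6) log₂ K`, which is absurd.
-/

namespace IQFS

open Term Formula

/-! ### Substitution and truth -/

theorem Term.eval_congr {t : Term} {v w : ℕ → ℕ} (h : ∀ n ∈ t.vars, v n = w n) :
    t.eval v = t.eval w := by
  induction t <;> simp_all [Term.vars, Term.eval]

theorem Term.eval_of_closed {t : Term} (ht : t.vars = ∅) (v w : ℕ → ℕ) : t.eval v = t.eval w :=
  Term.eval_congr (by simp [ht])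

theorem Term.subst_of_notMem {t : Term} {x : ℕ} {r : Term} (h : x ∉ t.vars) : t.subst x r = t := by
  induction t <;> simp_all [Term.vars, Term.subst]
  grind

theorem Term.close_of_closed {t : Term} {B : Finset ℕ} {r : Term} (h : t.vars = ∅) :
    t.close B r = t := by
  induction t <;> simp_all [Term.vars, Term.close]

theorem Term.eval_subst (t : Term) (x : ℕ) (r : Term) (v : ℕ → ℕ) :
    (t.subst x r).eval v = t.eval (Function.update v x (r.eval v)) := by
  induction t <;> simp_all [Term.subst, Term.eval]
  split_ifs <;> simp_all [Term.eval]

theorem Term.eval_close (t : Term) (B : Finset ℕ) {r : Term} (v : ℕ → ℕ) :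
    (t.close B r).eval v = t.eval (fun n => if n ∈ B then v n else r.eval v) := by
  induction t <;> simp_all [Term.close, Term.eval]
  split_ifs <;> simp_all [Term.eval]

theorem Term.vars_subst_subset (t : Term) (x : ℕ) (r : Term) :
    (t.subst x r).vars ⊆ t.vars.erase x ∪ r.vars := by
  induction t <;> simp_all [Term.subst, Term.vars] <;> grind [Term.vars]

theorem Term.vars_close_subset (t : Term) (B : Finset ℕ) {r : Term} (hr : r.vars = ∅) :
    (t.close B r).vars ⊆ B := by
  induction t <;> simp_all [Term.close, Term.vars] <;> grind [Term.vars]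

namespace Formula

theorem sat_congr {φ : Formula} {v w : ℕ → ℕ} (h : ∀ n ∈ φ.fv, v n = w n) :
    φ.Sat v ↔ φ.Sat w := by
  induction φ generalizing v w with
  | eq s t =>
    simp only [fv, Finset.mem_union] at h
    simp [Sat, Term.eval_congr fun n hn => h n (.inl hn),
      Term.eval_congr fun n hn => h n (.inr hn)]
  | le s t =>
    simp only [fv, Finset.mem_union] at h
    simp [Sat, Term.eval_congr fun n hn => h n (.inl hn),
      Term.eval_congr fun n hn => h n (.inr hn)]
  | neg φ ih => simp only [Sat, ih h]
  | imp φ ψ ih1 ih2 | and φ ψ ih1 ih2 | or φ ψ ih1 ih2 =>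
    simp only [fv, Finset.mem_union] at h
    simp only [Sat, ih1 fun n hn => h n (.inl hn), ih2 fun n hn => h n (.inr hn)]
  | all x φ ih =>
    refine forall_congr' fun a => ih fun n hn => ?_
    by_cases hx : n = x <;> simp_all [fv]
  | ex x φ ih =>
    refine exists_congr fun a => ih fun n hn => ?_
    by_cases hx : n = x <;> simp_all [fv]

theorem sat_update_of_notMem {φ : Formula} {x : ℕ} (h : x ∉ φ.fv) (v : ℕ → ℕ) (a : ℕ) :
    φ.Sat (Function.update v x a) ↔ φ.Sat v :=
  sat_congr fun n hn => by
    rw [Function.update_of_ne]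
    rintro rfl
    exact h hn

theorem IsSentence.isTrue {φ : Formula} (h : φ.IsSentence) {v : ℕ → ℕ} (hv : φ.Sat v) :
    IsTrue φ := fun w =>
  (sat_congr (v := v) (by simp [show φ.fv = ∅ from h])).1 hv

theorem fv_subst_subset (φ : Formula) (x : ℕ) (r : Term) :
    (φ.subst x r).fv ⊆ φ.fv.erase x ∪ r.vars := by
  induction φ with
  | eq s t | le s t =>
    have := Term.vars_subst_subset s x r
    have := Term.vars_subst_subset t x r
    simp only [subst, fv]
    grind
  | neg φ ih => exact ih
  | imp φ ψ ih1 ih2 | and φ ψ ih1 ih2 | or φ ψ ih1 ih2 =>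
    simp only [subst, fv]
    grind
  | all y φ ih | ex y φ ih =>
    simp only [subst]
    split_ifs <;> simp only [fv] <;> grind

theorem vars_subst_subset (φ : Formula) (x : ℕ) (r : Term) :
    (φ.subst x r).vars ⊆ φ.vars ∪ r.vars := by
  induction φ with
  | eq s t | le s t =>
    have := Term.vars_subst_subset s x r
    have := Term.vars_subst_subset t x r
    simp only [subst, vars]
    grind
  | neg φ ih => exact ih
  | imp φ ψ ih1 ih2 | and φ ψ ih1 ih2 | or φ ψ ih1 ih2 =>
    simp only [subst, vars]
    grind
  | all y φ ih | ex y φ ih =>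
    simp only [subst]
    split_ifs <;> simp only [vars] <;> grind

theorem subst_of_notMem_fv {φ : Formula} {x : ℕ} {r : Term} (h : x ∉ φ.fv) :
    φ.subst x r = φ := by
  induction φ with
  | eq s t | le s t =>
    simp only [fv, Finset.mem_union, not_or] at h
    simp [subst, Term.subst_of_notMem h.1, Term.subst_of_notMem h.2]
  | neg φ ih => simp [subst, ih h]
  | imp φ ψ ih1 ih2 | and φ ψ ih1 ih2 | or φ ψ ih1 ih2 =>
    simp only [fv, Finset.mem_union, not_or] at h
    simp [subst, ih1 h.1, ih2 h.2]
  | all y φ ih | ex y φ ih =>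
    simp only [fv, Finset.mem_erase, not_and] at h
    simp only [subst]
    split_ifs with hy
    · rfl
    · rw [ih (h (Ne.symm hy))]

/-- The substitution lemma. -/
theorem sat_subst {φ : Formula} {x : ℕ} {r : Term} (h : φ.Substitutable x r) (v : ℕ → ℕ) :
    (φ.subst x r).Sat v ↔ φ.Sat (Function.update v x (r.eval v)) := by
  induction φ generalizing v with
  | eq s t | le s t => simp [subst, Sat, Term.eval_subst]
  | neg φ ih => simp only [subst, Sat, ih h]
  | imp φ ψ ih1 ih2 | and φ ψ ih1 ih2 | or φ ψ ih1 ih2 =>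
    simp only [subst, Sat, ih1 h.1, ih2 h.2]
  | all y φ ih | ex y φ ih =>
    rcases h with h | ⟨hy, h⟩
    · rw [subst_of_notMem_fv h]
      exact (sat_update_of_notMem h v _).symm
    · by_cases hyx : y = x
      · subst hyx
        rw [subst, if_pos rfl, sat_update_of_notMem (by simp [fv])]
      · rw [subst, if_neg hyx]
        simp only [Sat]
        first | refine forall_congr' fun a => ?_ | refine exists_congr fun a => ?_
        rw [ih h, Function.update_comm (Ne.symm hyx),
          Term.eval_congr (v := Function.update v y a) (w := v)]
        intro n hn
        rw [Function.update_of_ne]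
        rintro rfl
        exact hy hn

theorem substitutable_of_disjoint {φ : Formula} {x : ℕ} {r : Term}
    (h : Disjoint r.vars φ.vars) : φ.Substitutable x r := by
  induction φ with
  | eq s t | le s t => trivial
  | neg φ ih => exact ih h
  | imp φ ψ ih1 ih2 | and φ ψ ih1 ih2 | or φ ψ ih1 ih2 =>
    simp only [Formula.vars, Finset.disjoint_union_right] at h
    exact ⟨ih1 h.1, ih2 h.2⟩
  | all y φ ih | ex y φ ih =>
    simp only [Formula.vars, Finset.disjoint_insert_right] at h
    exact .inr ⟨h.1, ih h.2⟩

theorem substitutable_of_closed (φ : Formula) (x : ℕ) {r : Term} (hr : r.vars = ∅) :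
    φ.Substitutable x r :=
  substitutable_of_disjoint (by simp [hr])

theorem sat_closeAux (φ : Formula) (B : Finset ℕ) {r : Term} (hr : r.vars = ∅) (v : ℕ → ℕ) :
    (φ.closeAux B r).Sat v ↔ φ.Sat (fun n => if n ∈ B then v n else r.eval v) := by
  induction φ generalizing v B with
  | eq s t | le s t => simp [closeAux, Sat, Term.eval_close]
  | neg φ ih => simp only [closeAux, Sat, ih]
  | imp φ ψ ih1 ih2 | and φ ψ ih1 ih2 | or φ ψ ih1 ih2 => simp only [closeAux, Sat, ih1, ih2]
  | all y φ ih | ex y φ ih =>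
    simp only [closeAux, Sat]
    first | refine forall_congr' fun a => ?_ | refine exists_congr fun a => ?_
    rw [ih]
    refine sat_congr fun n _ => ?_
    rw [Term.eval_of_closed hr (Function.update v y a) v]
    by_cases hn : n = y <;> simp [hn]

theorem fv_closeAux_subset (φ : Formula) (B : Finset ℕ) {r : Term} (hr : r.vars = ∅) :
    (φ.closeAux B r).fv ⊆ B := by
  induction φ generalizing B with
  | eq s t | le s t =>
    exact Finset.union_subset (Term.vars_close_subset s B hr) (Term.vars_close_subset t B hr)
  | neg φ ih => exact ih B
  | imp φ ψ ih1 ih2 | and φ ψ ih1 ih2 | or φ ψ ih1 ih2 =>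
    exact Finset.union_subset (ih1 B) (ih2 B)
  | all y φ ih | ex y φ ih =>
    have := ih (insert y B)
    simp only [closeAux, fv]
    grind

theorem sat_core (φ : Formula) (v : ℕ → ℕ) : φ.core.Sat v ↔ φ.Sat v := by
  induction φ generalizing v with
  | eq s t | le s t => rfl
  | neg φ ih | all x φ ih => simp only [core, Sat, ih]
  | ex x φ ih => simp only [core, Sat, ih, not_forall, not_not]
  | imp φ ψ ih1 ih2 => simp only [core, Sat, ih1, ih2]
  | and φ ψ ih1 ih2 => simp only [core, Sat, ih1, ih2]; tauto
  | or φ ψ ih1 ih2 => simp only [core, Sat, ih1, ih2]; tauto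

theorem core_subst (φ : Formula) (x : ℕ) (r : Term) :
    (φ.subst x r).core = φ.core.subst x r := by
  induction φ with
  | eq s t | le s t => rfl
  | neg φ ih => simp only [core, subst, ih]
  | imp φ ψ ih1 ih2 | and φ ψ ih1 ih2 | or φ ψ ih1 ih2 => simp only [core, subst, ih1, ih2]
  | all y φ ih | ex y φ ih =>
    simp only [core, subst]
    split_ifs <;> simp only [core, ih]

theorem fv_allList (xs : List ℕ) (φ : Formula) : (allList xs φ).fv = φ.fv \ xs.toFinset := by
  induction xs with
  | nil => simp [allList]
  | cons x xs ih =>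
    change (allList xs φ).fv.erase x = _
    rw [ih]
    ext n
    simp
    tauto

theorem vars_allList (xs : List ℕ) (φ : Formula) :
    (allList xs φ).vars = xs.toFinset ∪ φ.vars := by
  induction xs with
  | nil => simp [allList]
  | cons x xs ih =>
    change insert x (allList xs φ).vars = _
    rw [ih]
    simp

theorem sat_of_isTrue_allList {xs : List ℕ} {φ : Formula} (h : IsTrue (allList xs φ)) :
    IsTrue φ := by
  induction xs with
  | nil => exact h
  | cons x xs ih => exact ih fun v => by simpa [allList] using h v (v x)

theorem isTrue_allList {xs : List ℕ} {φ : Formula} (h : IsTrue φ) : IsTrue (allList xs φ) := by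
  induction xs with
  | nil => exact h
  | cons x xs ih => exact fun v a => ih _

end Formula

/-! ### Numerals -/

theorem thetaFn_two_pow (j : ℕ) : thetaFn (2 ^ j) = 2 ^ (j + 1) := by
  simp [thetaFn, Nat.log_pow, pow_succ, mul_comm]

theorem eval_thetaPow (j : ℕ) (v : ℕ → ℕ) : (thetaPow j).eval v = 2 ^ j := by
  induction j with
  | zero => rfl
  | succ j ih => rw [thetaPow, Term.eval, ih, thetaFn_two_pow]

theorem eval_thetaMax (j : ℕ) (v : ℕ → ℕ) : (thetaMax j).eval v = 2 ^ (j + 1) := by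
  induction j with
  | zero => exact thetaFn_two_pow 0
  | succ j ih =>
    rw [thetaMax, Term.eval, ih, eval_thetaPow]
    exact max_eq_left (Nat.pow_le_pow_right (by norm_num) (by omega))

theorem eval_half_iterate (k : ℕ) (t : Term) (v : ℕ → ℕ) :
    (half^[k] t).eval v = t.eval v / 2 ^ k := by
  induction k with
  | zero => simp
  | succ k ih =>
    rw [Function.iterate_succ_apply', half, Term.eval, ih, Term.eval, Nat.div_div_eq_div_mul,
      pow_succ]

theorem eval_E (j : ℕ) (v : ℕ → ℕ) : (E j).eval v = 2 ^ j := by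
  cases j with
  | zero => rfl
  | succ j => rw [E, Term.eval, eval_half_iterate, eval_thetaMax]; simp

theorem vars_thetaPow (j : ℕ) : (thetaPow j).vars = ∅ := by
  induction j with
  | zero => rfl
  | succ j ih => exact ih

theorem vars_thetaMax (j : ℕ) : (thetaMax j).vars = ∅ := by
  induction j with
  | zero => rfl
  | succ j ih => simp [thetaMax, Term.vars, ih, vars_thetaPow]

theorem vars_half_iterate (k : ℕ) (t : Term) : (half^[k] t).vars = t.vars := by
  induction k with
  | zero => rfl
  | succ k ih => simp [Function.iterate_succ_apply', half, Term.vars, ih]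

theorem vars_E (j : ℕ) : (E j).vars = ∅ := by
  cases j with
  | zero => rfl
  | succ j => rw [E, Term.vars, vars_half_iterate, vars_thetaMax]; rfl

theorem vars_eq_empty_of_mem_qConsts {t : Term} (h : t ∈ qConsts) : t.vars = ∅ := by
  rcases h with (rfl | rfl | rfl) | ⟨j, -, rfl⟩
  exacts [rfl, rfl, rfl, vars_E j]

theorem powTerm_mem_qConsts (j : ℕ) : powTerm j ∈ qConsts := by
  match j with
  | 0 => exact .inl (.inr (.inl rfl))
  | 1 => exact .inl (.inr (.inr rfl))
  | j + 2 => exact .inr ⟨j + 2, by omega, rfl⟩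

theorem eval_powTerm (j : ℕ) (v : ℕ → ℕ) : (powTerm j).eval v = 2 ^ j := by
  match j with
  | 0 => rfl
  | 1 => rfl
  | j + 2 => exact eval_E (j + 2) v

theorem isTermOver_num (n : ℕ) : IsTermOver qConsts (num n) := by
  have key (l : List ℕ) (t : Term) (ht : IsTermOver qConsts t) :
      IsTermOver qConsts (l.foldl (fun t i => .sub t (powTerm i)) t) := by
    induction l generalizing t with
    | nil => exact ht
    | cons i l ih => exact ih _ (.sub ht (.const (powTerm_mem_qConsts i)))
  rw [num]
  split_ifs
  · exact .const (.inl (.inl rfl))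
  · exact key _ _ (.const (powTerm_mem_qConsts _))

theorem vars_num (n : ℕ) : (num n).vars = ∅ := by
  have key (l : List ℕ) (t : Term) (ht : t.vars = ∅) :
      (l.foldl (fun t i => .sub t (powTerm i)) t).vars = ∅ := by
    induction l generalizing t with
    | nil => exact ht
    | cons i l ih =>
      exact ih _ (by simp [Term.vars, ht, vars_eq_empty_of_mem_qConsts (powTerm_mem_qConsts i)])
  rw [num]
  split_ifs
  · rfl
  · exact key _ _ (vars_eq_empty_of_mem_qConsts (powTerm_mem_qConsts _))

theorem sum_two_pow_testBit (m k : ℕ) :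
    (((List.range k).filter fun i => m.testBit i).map (2 ^ ·)).sum = m % 2 ^ k := by
  induction k with
  | zero => simp [Nat.mod_one]
  | succ k ih =>
    rw [List.range_succ, List.filter_append, List.map_append, List.sum_append, ih,
      Nat.mod_pow_succ]
    rcases Nat.mod_two_eq_zero_or_one (m / 2 ^ k) with h | h <;>
      simp [h, Nat.testBit_eq_decide_div_mod_eq]

theorem eval_num (n : ℕ) (v : ℕ → ℕ) : (num n).eval v = n := by
  have key (l : List ℕ) (t : Term) :
      (l.foldl (fun t i => .sub t (powTerm i)) t).eval v = t.eval v - (l.map (2 ^ ·)).sum := by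
    induction l generalizing t with
    | nil => simp
    | cons i l ih => simp [ih, Term.eval, eval_powTerm, Nat.sub_sub]
  rw [num]
  split_ifs with hn
  · exact hn.symm
  · have h1 : n ≤ 2 ^ Nat.clog 2 n := Nat.le_pow_clog (by norm_num) n
    rw [key, eval_powTerm, List.filter_reverse, List.map_reverse, List.sum_reverse,
      sum_two_pow_testBit, Nat.mod_eq_of_lt (by omega)]
    omega

/-! ### Closure properties of `Δ₀^Q` formulas -/

theorem IsTermOver.subst {C : Set Term} (hC : ∀ t ∈ C, t.vars = ∅) {r t : Term}
    (ht : IsTermOver C t) (hr : IsTermOver C r) (x : ℕ) :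
    IsTermOver C (t.subst x r) := by
  induction ht with
  | var n =>
    rw [Term.subst]
    split_ifs
    · exact hr
    · exact .var n
  | const h =>
    rw [Term.subst_of_notMem (by simp [hC _ h])]
    exact .const h
  | sub _ _ h1 h2 => exact .sub h1 h2
  | div _ _ h1 h2 => exact .div h1 h2
  | max _ _ h1 h2 => exact .max h1 h2
  | root _ _ h1 h2 => exact .root h1 h2
  | log _ h => exact .log h
  | count _ _ h1 h2 => exact .count h1 h2

theorem IsTermOver.close {C : Set Term} (hC : ∀ t ∈ C, t.vars = ∅) {r t : Term}
    (ht : IsTermOver C t) (hr : IsTermOver C r) (B : Finset ℕ) :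
    IsTermOver C (t.close B r) := by
  induction ht with
  | var n =>
    rw [Term.close]
    split_ifs
    · exact .var n
    · exact hr
  | const h =>
    rw [Term.close_of_closed (hC _ h)]
    exact .const h
  | sub _ _ h1 h2 => exact .sub h1 h2
  | div _ _ h1 h2 => exact .div h1 h2
  | max _ _ h1 h2 => exact .max h1 h2
  | root _ _ h1 h2 => exact .root h1 h2
  | log _ h => exact .log h
  | count _ _ h1 h2 => exact .count h1 h2

/-- The variables of `r` have to be fresh because `∀ x ≤ t φ` is a bounded quantifier only if `x`
does not occur in `t`. -/
theorem IsDelta0Over.subst {C : Set Term} (hC : ∀ t ∈ C, t.vars = ∅) {r : Term}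
    (hr : IsTermOver C r) {φ : Formula} (hφ : IsDelta0Over C φ) (x : ℕ)
    (hd : Disjoint r.vars φ.vars) : IsDelta0Over C (φ.subst x r) := by
  induction hφ with
  | eq h1 h2 => exact .eq (h1.subst hC hr x) (h2.subst hC hr x)
  | le h1 h2 => exact .le (h1.subst hC hr x) (h2.subst hC hr x)
  | neg _ ih => exact .neg (ih hd)
  | imp _ _ ih1 ih2 =>
    simp only [Formula.vars, Finset.disjoint_union_right] at hd
    exact .imp (ih1 hd.1) (ih2 hd.2)
  | and _ _ ih1 ih2 =>
    simp only [Formula.vars, Finset.disjoint_union_right] at hd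
    exact .and (ih1 hd.1) (ih2 hd.2)
  | or _ _ ih1 ih2 =>
    simp only [Formula.vars, Finset.disjoint_union_right] at hd
    exact .or (ih1 hd.1) (ih2 hd.2)
  | @ball y t ψ h1 h2 h3 ih =>
    simp only [Formula.vars, Finset.disjoint_insert_right, Finset.disjoint_union_right] at hd
    rw [Formula.subst]
    split_ifs with hy
    · exact .ball h1 h2 h3
    · simp only [Formula.subst, Term.subst, if_neg hy]
      refine .ball (h1.subst hC hr x) (fun h => ?_) (ih hd.2.2)
      have := Term.vars_subst_subset t x r h
      grind
  | @bex y t ψ h1 h2 h3 ih =>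
    simp only [Formula.vars, Finset.disjoint_insert_right, Finset.disjoint_union_right] at hd
    rw [Formula.subst]
    split_ifs with hy
    · exact .bex h1 h2 h3
    · simp only [Formula.subst, Term.subst, if_neg hy]
      refine .bex (h1.subst hC hr x) (fun h => ?_) (ih hd.2.2)
      have := Term.vars_subst_subset t x r h
      grind

theorem Term.notMem_vars_close {t : Term} {x : ℕ} (h : x ∉ t.vars) (B : Finset ℕ) {r : Term}
    (hr : r.vars = ∅) : x ∉ (t.close B r).vars := by
  induction t <;> simp_all [Term.close, Term.vars]
  split_ifs <;> simp_all [Term.vars]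

theorem IsDelta0Over.closeAux {C : Set Term} (hC : ∀ t ∈ C, t.vars = ∅) {r : Term}
    (hr : IsTermOver C r) (hrv : r.vars = ∅) {φ : Formula} (hφ : IsDelta0Over C φ)
    (B : Finset ℕ) : IsDelta0Over C (φ.closeAux B r) := by
  induction hφ generalizing B with
  | eq h1 h2 => exact .eq (h1.close hC hr B) (h2.close hC hr B)
  | le h1 h2 => exact .le (h1.close hC hr B) (h2.close hC hr B)
  | neg _ ih => exact .neg (ih B)
  | imp _ _ ih1 ih2 => exact .imp (ih1 B) (ih2 B)
  | and _ _ ih1 ih2 => exact .and (ih1 B) (ih2 B)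
  | or _ _ ih1 ih2 => exact .or (ih1 B) (ih2 B)
  | @ball y t ψ h1 h2 h3 ih =>
    simp only [Formula.closeAux, Term.close, if_pos (Finset.mem_insert_self y B)]
    exact .ball (h1.close hC hr _) (Term.notMem_vars_close h2 _ hrv) (ih _)
  | @bex y t ψ h1 h2 h3 ih =>
    simp only [Formula.closeAux, Term.close, if_pos (Finset.mem_insert_self y B)]
    exact .bex (h1.close hC hr _) (Term.notMem_vars_close h2 _ hrv) (ih _)

theorem IsDelta0Q.subst_num {φ : Formula} (hφ : IsDelta0Q φ) (x n : ℕ) :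
    IsDelta0Q (φ.subst x (num n)) :=
  IsDelta0Over.subst (fun _ => vars_eq_empty_of_mem_qConsts) (isTermOver_num n) hφ x
    (by simp [vars_num])

theorem sat_subst_num (φ : Formula) (x n : ℕ) (v : ℕ → ℕ) :
    (φ.subst x (num n)).Sat v ↔ φ.Sat (Function.update v x n) := by
  rw [sat_subst (substitutable_of_closed φ x (vars_num n)), eval_num]

theorem IsTermOver.mono {C D : Set Term} (h : C ⊆ D) {t : Term} (ht : IsTermOver C t) :
    IsTermOver D t := by
  induction ht with
  | var n => exact .var n
  | const hm => exact .const (h hm)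
  | sub _ _ h1 h2 => exact .sub h1 h2
  | div _ _ h1 h2 => exact .div h1 h2
  | max _ _ h1 h2 => exact .max h1 h2
  | root _ _ h1 h2 => exact .root h1 h2
  | log _ h => exact .log h
  | count _ _ h1 h2 => exact .count h1 h2

theorem IsDelta0Over.mono {C D : Set Term} (h : C ⊆ D) {φ : Formula} (hφ : IsDelta0Over C φ) :
    IsDelta0Over D φ := by
  induction hφ with
  | eq h1 h2 => exact .eq (h1.mono h) (h2.mono h)
  | le h1 h2 => exact .le (h1.mono h) (h2.mono h)
  | neg _ ih => exact .neg ih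
  | imp _ _ ih1 ih2 => exact .imp ih1 ih2
  | and _ _ ih1 ih2 => exact .and ih1 ih2
  | or _ _ ih1 ih2 => exact .or ih1 ih2
  | ball h1 h2 _ ih => exact .ball (h1.mono h) h2 ih
  | bex h1 h2 _ ih => exact .bex (h1.mono h) h2 ih

theorem IsSimplePi1Q.isPi1Q {Φ : Formula} (h : IsSimplePi1Q Φ) : IsPi1Q Φ :=
  let ⟨h1, xs, φ, h2, h3⟩ := h
  ⟨h1, xs, φ, h2.mono Set.subset_union_left, h3⟩

/-- Substitution of a numeral in the sentence `∀ x₁ … ∀ xₖ φ` acts on the matrix, or not at all if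
the variable is one of the `xᵢ`; in both cases the matrix remains `Δ₀^Q`. -/
theorem exists_allList_subst_num (xs : List ℕ) {φ : Formula} (hφ : IsDelta0Q φ) (x n : ℕ) :
    ∃ ψ, IsDelta0Q ψ ∧ (allList xs φ).subst x (num n) = allList xs ψ := by
  induction xs with
  | nil => exact ⟨_, hφ.subst_num x n, rfl⟩
  | cons y xs ih =>
    obtain ⟨ψ, hψ, h⟩ := ih
    by_cases hy : y = x
    · exact ⟨φ, hφ, if_pos hy⟩
    · exact ⟨ψ, hψ, (if_neg hy).trans (congrArg (all y) h)⟩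

/-! ### The proof calculus -/

theorem Justified.mono {α γ : Set Formula} (hα : α ⊆ γ) {l m : List Formula} (hl : l ⊆ m)
    {φ : Formula} (h : Justified α l φ) : Justified γ m φ := by
  rcases h with h | h | ⟨ψ, h1, χ, h2, h3⟩
  exacts [.inl (hα h), .inr (.inl h), .inr (.inr ⟨ψ, hl h1, χ, hl h2, h3⟩)]

theorem IsDerivation.mono {α γ : Set Formula} (hα : α ⊆ γ) {l : List Formula}
    (h : IsDerivation α l) : IsDerivation γ l := by
  induction h with
  | nil => exact .nil
  | snoc _ h ih => exact .snoc ih (h.mono hα (List.Subset.refl _))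

theorem IsDerivation.append {α : Set Formula} {l m : List Formula} (hl : IsDerivation α l)
    (hm : IsDerivation α m) : IsDerivation α (l ++ m) := by
  induction hm with
  | nil => simpa using hl
  | snoc _ h ih =>
    rw [← List.append_assoc]
    exact .snoc ih (h.mono Set.Subset.rfl (List.subset_append_right _ _))

theorem IsProof.mono {α γ : Set Formula} (hα : α ⊆ γ) {φ : Formula} {l : List Formula}
    (h : IsProof α φ l) : IsProof γ φ l :=
  ⟨h.1.mono hα, h.2⟩

theorem Provable.mono {α γ : Set Formula} (hα : α ⊆ γ) {φ : Formula} (h : Provable α φ) :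
    Provable γ φ :=
  h.imp fun _ hl => hl.mono hα

theorem IsProof.mem {α : Set Formula} {φ : Formula} {l : List Formula} (h : IsProof α φ l) :
    φ ∈ l :=
  List.mem_of_getLast? h.2

theorem provable_of_mem {α : Set Formula} {φ : Formula} (h : φ ∈ α) : Provable α φ :=
  ⟨[φ], .snoc .nil (.inl h), rfl⟩

theorem provable_of_logicalAxiom {α : Set Formula} {φ : Formula} (h : LogicalAxiom φ.core) :
    Provable α φ :=
  ⟨[φ], .snoc .nil (.inr (.inl h)), rfl⟩

theorem Provable.mp {α : Set Formula} {φ ψ : Formula} (h : Provable α (.imp φ ψ))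
    (hφ : Provable α φ) : Provable α ψ := by
  obtain ⟨l, hl⟩ := h
  obtain ⟨m, hm⟩ := hφ
  refine ⟨l ++ m ++ [ψ], .snoc (hl.1.append hm.1) (.inr (.inr ⟨φ, ?_, .imp φ ψ, ?_, rfl⟩)), ?_⟩
  · exact List.mem_append_right _ hm.mem
  · exact List.mem_append_left _ hl.mem
  · simp

theorem provable_of_not_consistent {α : Set Formula} (h : ¬ Consistent α) (φ : Formula) :
    Provable α φ := by
  obtain ⟨ψ, h1, h2⟩ := not_not.1 h
  have h3 : Provable α (.imp (.neg φ) (.neg ψ)) :=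
    (provable_of_logicalAxiom (.one ψ.neg.core φ.neg.core) :
      Provable α (.imp (.neg ψ) (.imp (.neg φ) (.neg ψ)))).mp h2
  have h4 : Provable α (.imp (.neg φ) ψ) :=
    (provable_of_logicalAxiom (.one ψ.core φ.neg.core) :
      Provable α (.imp ψ (.imp (.neg φ) ψ))).mp h1
  have h5 : Provable α (.imp (.imp (.neg φ) (.neg ψ)) (.imp (.imp (.neg φ) ψ) φ)) :=
    provable_of_logicalAxiom (.three ψ.core φ.core)
  exact (h5.mp h3).mp h4

theorem Provable.inst_num {α : Set Formula} {x : ℕ} {φ : Formula} (h : Provable α (.all x φ))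
    (n : ℕ) : Provable α (φ.subst x (num n)) := by
  refine (provable_of_logicalAxiom ?_ : Provable α (.imp (.all x φ) _)).mp h
  rw [core, core, core_subst]
  exact .inst x (num n) φ.core (substitutable_of_closed _ _ (vars_num n))

theorem LogicalAxiom.isTrue {φ : Formula} (h : LogicalAxiom φ) : IsTrue φ := by
  induction h with
  | one B C => intro v; simp only [Sat]; tauto
  | two B C D => intro v; simp only [Sat]; tauto
  | three B C => intro v; simp only [Sat]; tauto
  | inst x t φ h => exact fun v hv => (sat_subst h v).2 (hv _)
  | dist x φ ψ => exact fun v h1 h2 a => h1 a (h2 a)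
  | vac x φ h => exact fun v hv a => (sat_update_of_notMem h v a).2 hv
  | gen x _ ih => exact fun v a => ih _

/-- Soundness of the proof calculus in the standard model. -/
theorem Provable.isTrue {α : Set Formula} (hα : ∀ φ ∈ α, IsTrue φ) {φ : Formula}
    (h : Provable α φ) : IsTrue φ := by
  obtain ⟨l, hl⟩ := h
  suffices ∀ l, IsDerivation α l → ∀ ψ ∈ l, IsTrue ψ from this l hl.1 φ hl.mem
  intro l hl
  induction hl with
  | nil => simp
  | snoc _ hj ih =>
    intro ψ hψ
    rcases List.mem_append.1 hψ with hψ | hψ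
    · exact ih ψ hψ
    · obtain rfl := List.mem_singleton.1 hψ
      rcases hj with h | h | ⟨χ, h1, ξ, h2, h3⟩
      · exact hα _ h
      · exact fun v => (sat_core _ v).1 (h.isTrue v)
      · intro v
        have h4 := (sat_core ξ v).2 (ih ξ h2 v)
        rw [h3] at h4
        exact (sat_core _ v).1 (h4 ((sat_core χ v).2 (ih χ h1 v)))

theorem not_isTrue_zeroEqOne : ¬ IsTrue zeroEqOne := fun h =>
  absurd (h fun _ => 0) (by simp [zeroEqOne, Sat, Term.eval])

theorem IsDerivation.of_notMem {α : Set Formula} {g : Formula} {l : List Formula}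
    (h : IsDerivation (α ∪ {g}) l) (hg : g ∉ l) : IsDerivation α l := by
  induction h with
  | nil => exact .nil
  | snoc _ hj ih =>
    simp only [List.mem_append, List.mem_singleton, not_or] at hg
    refine .snoc (ih hg.1) ?_
    rcases hj with (h | h) | h
    exacts [.inl h, absurd h.symm hg.2, .inr h]

/-! ### Gödel numbers of proofs -/

theorem bytesToNat_le_append (a b c : List ℕ) : bytesToNat b ≤ bytesToNat (a ++ b ++ c) := by
  simp only [bytesToNat, List.reverse_append, Nat.ofDigits_append]
  have h1 : 1 ≤ 64 ^ c.reverse.length := Nat.one_le_pow _ _ (by norm_num)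
  calc Nat.ofDigits 64 b.reverse ≤ 64 ^ c.reverse.length * Nat.ofDigits 64 b.reverse :=
        Nat.le_mul_of_pos_left _ h1
    _ ≤ 64 ^ c.reverse.length * (Nat.ofDigits 64 b.reverse +
          64 ^ b.reverse.length * Nat.ofDigits 64 a.reverse) :=
        Nat.mul_le_mul_left _ (Nat.le_add_right _ _)
    _ ≤ _ := Nat.le_add_left _ _

theorem code_le_proofCode {φ : Formula} {l : List Formula} (h : φ ∈ l) :
    φ.code ≤ proofCode l := by
  obtain ⟨s, t, rfl⟩ := List.append_of_mem h
  simpa only [proofCode, Formula.code, List.flatMap_append, List.flatMap_cons,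
    List.append_assoc] using
    bytesToNat_le_append (s.flatMap fun φ => φ.bytes ++ [41]) φ.bytes
      ([41] ++ t.flatMap fun φ => φ.bytes ++ [41])

theorem IsProofCode.mono {α γ : Set Formula} (hα : α ⊆ γ) {φ : Formula} {p : ℕ}
    (h : IsProofCode α φ p) : IsProofCode γ φ p :=
  h.imp fun _ hl => ⟨hl.1.mono hα, hl.2⟩

theorem IsProofCode.code_le {α : Set Formula} {φ : Formula} {p : ℕ} (h : IsProofCode α φ p) :
    φ.code ≤ p := by
  obtain ⟨l, hl, rfl⟩ := h
  exact code_le_proofCode hl.mem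

/-! ### Truth of the Groups 0, 1 and 2 -/

theorem sat_powerF (t : Term) (v : ℕ → ℕ) :
    (powerF t).Sat v ↔ 2 ^ Nat.log 2 (t.eval v) = t.eval v := by
  simp only [powerF, Sat, pred, Term.eval]
  generalize t.eval v = n
  constructor
  · rintro (rfl | h)
    · simp
    · have hn : n ≠ 0 := by rintro rfl; simp at h
      refine le_antisymm (Nat.pow_log_le_self 2 hn) ?_
      by_contra! hlt
      refine h (le_antisymm ?_ (Nat.log_mono_right (Nat.sub_le n 1)))
      exact Nat.le_log_of_pow_le (by norm_num) (by omega)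
  · intro h
    by_cases h1 : n = 1
    · exact .inl h1
    · right
      intro h2
      have h3 : n - 1 < 2 ^ Nat.log 2 (n - 1) := by
        rw [← h2, h]
        have : n ≠ 0 := by rintro rfl; simp at h
        omega
      have h4 : n ≠ 0 := by rintro rfl; simp at h
      exact absurd (Nat.pow_log_le_self 2 (x := n - 1) (by omega)) (by omega)

theorem isTrue_of_mem_group0 {φ : Formula} (h : φ ∈ group0) : IsTrue φ := by
  rcases h with rfl | rfl | rfl | rfl | rfl | rfl <;> intro v
  · simp only [startAxiom, pred, Formula.lt, Sat, Term.eval, Function.update_self]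
    exact ⟨by norm_num, by norm_num, by norm_num, by norm_num, fun a => by omega⟩
  · intro a
    simp only [Sat, sat_powerF, Term.eval, Function.update_self]
    intro ha
    rw [← ha, thetaFn_two_pow, Nat.log_pow (by norm_num)]
  · intro a
    simp only [Sat, Term.eval, Function.update_self, thetaFn]
    split_ifs
    · omega
    · exact not_false
  · intro a b
    have h01 : Function.update (Function.update v 0 a) 1 b 0 = a := by simp
    simp only [Sat, sat_powerF, Term.eval, Function.update_self, h01, thetaFn]
    rintro ⟨hab, ha⟩
    have : 0 < 2 ^ Nat.log 2 a := by positivity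
    rw [if_pos ha]
    split_ifs <;> omega
  · intro a
    simp only [Sat, sat_powerF, Term.eval, Function.update_self, thetaFn]
    exact fun ha => if_neg ha
  · intro a
    simp only [Sat, sat_powerF, Term.eval, Function.update_self, half]
    rintro ⟨ha, h2⟩
    rw [← ha] at h2 ⊢
    generalize Nat.log 2 a = k at *
    cases k with
    | zero => simp at h2
    | succ k => rw [pow_succ, Nat.mul_div_cancel _ (by norm_num)]; simp

/-- A `Π₁^Q` theorem of a system that is consistent with the Groups 0 and 1 is true: otherwise its
refuting instance would be a false `Δ₀^Q` theorem, whose negation the two groups prove. -/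
theorem isTrue_of_provable {S α : Set Formula} (hS : IsGroup1 S)
    (hα : Consistent (α ∪ (group0 ∪ S))) {Φ : Formula} (hΦ : IsPi1Q Φ)
    (h : Provable α Φ) : IsTrue Φ := by
  obtain ⟨hs, xs, φ, hφ, rfl⟩ := hΦ
  induction xs generalizing φ with
  | nil =>
    by_contra hf
    obtain ⟨v, hv⟩ := not_forall.1 hf
    have hneg : Provable (group0 ∪ S) (.neg φ) :=
      hS.2.2.2.1 _ (.neg hφ) hs (IsSentence.isTrue (φ := .neg φ) hs hv)
    exact hα ⟨φ, h.mono Set.subset_union_left, hneg.mono Set.subset_union_right⟩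
  | cons x xs ih =>
    intro v a
    obtain ⟨ψ, hψ, he⟩ := exists_allList_subst_num xs hφ x a
    have hsent : (allList xs ψ).IsSentence := by
      have h1 := fv_subst_subset (allList xs φ) x (num a)
      have h2 : (allList xs φ).fv.erase x = ∅ := hs
      rw [he, h2, vars_num] at h1
      exact Finset.subset_empty.1 h1
    have h2 : Provable α ((allList xs φ).subst x (num a)) := Provable.inst_num h a
    have h3 := ih ψ hψ (he ▸ h2) hsent v
    rwa [← he, sat_subst_num] at h3

theorem isTrue_of_mem_group1 {S : Set Formula} (hS : IsGroup1 S) {Φ : Formula} (h : Φ ∈ S) :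
    IsTrue Φ :=
  isTrue_of_provable (α := group0 ∪ S) hS (by simpa using hS.2.2.1) (hS.2.1 Φ h).isPi1Q
    (provable_of_mem (.inr h))

/-- The Group-2 axioms are true `Π₁^Q` sentences, as the theory they reflect on proves only true
`Π₁^Q` sentences. -/
theorem isPi1Q_and_isTrue_of_mem_group2 {S β : Set Formula} (hS : IsGroup1 S)
    (hβ : Consistent (β ∪ (group0 ∪ S))) {H : Formula} (hH : ExpressesPrf β 0 1 H)
    {χ : Formula} (hχ : χ ∈ group2 H) : IsPi1Q χ ∧ IsTrue χ := by
  obtain ⟨xs, φ, hφ, hs, rfl⟩ := hχ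
  obtain ⟨hH0, hHfv, hHsat⟩ := hH
  simp only [group2Axiom]
  set y := (H.vars ∪ (allList xs φ).vars).sup id + 1 with hy
  set c := (allList xs φ).code with hc
  have hfresh : ∀ n ∈ H.vars ∪ (allList xs φ).vars, n ≠ y := fun n hn => by
    have : n ≤ (H.vars ∪ (allList xs φ).vars).sup id := Finset.le_sup (f := id) hn
    omega
  have hyH : y ∉ H.vars := fun h => hfresh y (Finset.mem_union_left _ h) rfl
  have hyxs : y ∉ xs.toFinset := fun h =>
    hfresh y (Finset.mem_union_right _ (by simp [vars_allList, List.mem_toFinset.1 h])) rfl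
  have hd : Disjoint (Term.var y).vars (H.subst 0 (num c)).vars := by
    have := vars_subst_subset H 0 (num c)
    rw [vars_num, Finset.union_empty] at this
    exact Finset.disjoint_singleton_left.2 fun h => hyH (this h)
  have hfv : ((H.subst 0 (num c)).subst 1 (.var y)).fv ⊆ {y} := by
    have h1 := fv_subst_subset H 0 (num c)
    have h2 := fv_subst_subset (H.subst 0 (num c)) 1 (.var y)
    rw [vars_num] at h1
    simp only [Term.vars] at h2
    intro n hn
    have h3 := h2 hn
    simp only [Finset.mem_union, Finset.mem_erase, Finset.mem_singleton] at h3 ⊢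
    rcases h3 with ⟨h3, h4⟩ | h3
    · have h5 := h1 h4
      simp only [Finset.mem_union, Finset.mem_erase, Finset.notMem_empty, or_false] at h5
      have h6 := hHfv h5.2
      simp only [Finset.mem_insert, Finset.mem_singleton] at h6
      omega
    · exact h3
  refine ⟨⟨?_, y :: xs, _, .imp (IsDelta0Over.subst (fun _ => vars_eq_empty_of_mem_qConsts)
    (.var y) (hH0.subst_num 0 c) 1 hd) hφ, rfl⟩, ?_⟩
  · change (allList (y :: xs) _).fv = ∅
    have hs' : φ.fv \ xs.toFinset = ∅ := by rw [← fv_allList]; exact hs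
    rw [Finset.sdiff_eq_empty_iff_subset] at hs'
    rw [fv_allList, Finset.sdiff_eq_empty_iff_subset, fv, List.toFinset_cons]
    exact Finset.union_subset (hfv.trans (by simp)) (hs'.trans (Finset.subset_insert _ _))
  · refine isTrue_allList (xs := [y]) (isTrue_allList fun v hv => ?_)
    rw [sat_subst (substitutable_of_disjoint hd), sat_subst_num] at hv
    have hp := (hHsat _ (allList xs φ) (by simp [hc])).1 hv
    obtain ⟨l, hl, -⟩ := hp
    exact sat_of_isTrue_allList (isTrue_of_provable hS hβ ⟨hs, xs, φ, hφ, rfl⟩ ⟨l, hl⟩) v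

/-! ### The Group-3 sentence -/

/-- The matrix of the Group-3 sentence, so that `group3 A X D` is `∀ p gammaMatrix A X D`. -/
def gammaMatrix (A X D : Formula) : Formula :=
  (Formula.neg ((Formula.or A
    (.ex 3 (.and (.le (var 3) (var 2)) (.and D X)))).subst 1 (num zeroEqOne.code))).closeAux {2}
      (num (gammaF A X D).code)

theorem group3_eq (A X D : Formula) : group3 A X D = .all 2 (gammaMatrix A X D) := rfl

theorem isPi1Q_group3 {A X D : Formula} (hA : IsDelta0Q A) (hX : IsDelta0Q X) (hD : IsDelta0Q D) :
    IsPi1Q (group3 A X D) := by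
  refine ⟨?_, [2], gammaMatrix A X D, ?_, rfl⟩
  · exact Finset.subset_empty.1 (fv_closeAux_subset _ ∅ (vars_num _))
  · refine IsDelta0Over.closeAux (fun _ => vars_eq_empty_of_mem_qConsts) (isTermOver_num _)
      (vars_num _) (.neg (IsDelta0Q.subst_num ?_ 1 _)) {2}
    exact .or hA (.bex (.var 2) (by simp [Term.vars]) (.and hD hX))

/-- The matrix of the Group-3 sentence at `p` denies that `p` is a proof of `0 = 1` from `U`, or
from `U` and the Group-3 sentence; the bound `h ≤ p` costs the condition on the Gödel number. -/
theorem sat_gammaMatrix {U : Set Formula} {A X D : Formula} (hA : ExpressesPrf U 1 2 A)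
    (hX : ExpressesExPrf U 3 1 2 X) (hD : ExpressesSubst 0 3 D) (v : ℕ → ℕ) :
    (gammaMatrix A X D).Sat v ↔ ¬ (IsProofCode U zeroEqOne (v 2) ∨
      (group3 A X D).code ≤ v 2 ∧ IsProofCode (U ∪ {group3 A X D}) zeroEqOne (v 2)) := by
  rw [gammaMatrix, sat_closeAux _ _ (vars_num _)]
  simp only [Sat, eval_num]
  rw [sat_subst_num]
  simp only [Sat, Term.eval]
  refine not_congr (or_congr ?_ ?_)
  · rw [hA.2.2 _ zeroEqOne (by simp)]
    simp
  · constructor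
    · rintro ⟨h, hle, hDs, hXs⟩
      have hh := (hD.2.2 _ (gammaF A X D) (by simp)).1 hDs
      have hh' : h = (group3 A X D).code := by simpa [group3] using hh
      have hx := (hX.2.2 _ (group3 A X D) zeroEqOne (by simpa using hh') (by simp)).1 hXs
      subst hh'
      exact ⟨by simpa using hle, by simpa using hx⟩
    · rintro ⟨hle, hp⟩
      refine ⟨(group3 A X D).code, by simpa using hle, ?_, ?_⟩
      · exact (hD.2.2 _ (gammaF A X D) (by simp)).2 (by simp [group3])
      · exact (hX.2.2 _ (group3 A X D) zeroEqOne (by simp) (by simp)).2 (by simpa using hp)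

end IQFS

theorem theorem1 (S : Set IQFS.Formula) (hS : IQFS.IsGroup1 S)
    (conjecture : IQFS.BreakingPointConjecture S) : IQFS.ConsistencyPreserving S := by
  open IQFS in
  rintro β hβ T ⟨H, A, X, D, hH, hA, hX, hD, rfl⟩
  have hgroup2 : ∀ χ ∈ group2 H, IsPi1Q χ ∧ IsTrue χ := fun χ =>
    isPi1Q_and_isTrue_of_mem_group2 hS hβ hH
  have hU : ∀ χ ∈ unionAxioms S H, IsTrue χ := by
    rintro χ ((h | h) | h)
    exacts [isTrue_of_mem_group0 h, isTrue_of_mem_group1 hS h, (hgroup2 χ h).2]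
  by_contra hT
  have hex : ∃ p, IsProofCode (unionAxioms S H ∪ {group3 A X D}) zeroEqOne p := by
    obtain ⟨l, hl⟩ := provable_of_not_consistent hT zeroEqOne
    exact ⟨_, l, hl, rfl⟩
  obtain ⟨K, hK, hmin⟩ : ∃ K, IsProofCode (unionAxioms S H ∪ {group3 A X D}) zeroEqOne K ∧
      ∀ k < K, ¬ IsProofCode (unionAxioms S H ∪ {group3 A X D}) zeroEqOne k :=
    by classical exact ⟨Nat.find hex, Nat.find_spec hex, fun _ => Nat.find_min hex⟩
  -- The proof must contain the Group-3 sentence, as it would otherwise be a proof from true axioms.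
  have hle : (group3 A X D).code ≤ K := by
    obtain ⟨l, hl, rfl⟩ := hK
    refine code_le_proofCode ?_
    by_contra hg
    exact not_isTrue_zeroEqOne (Provable.isTrue hU ⟨l, hl.1.of_notMem hg, hl.2⟩)
  have hbreak : IsBreakingPoint (group3 A X D) K := by
    refine ⟨isPi1Q_group3 hA.1 hX.1 hD.1, 2, gammaMatrix A X D, group3_eq A X D, ?_, ?_⟩
    · rw [sat_gammaMatrix hA hX hD, not_not, Function.update_self]
      exact .inr ⟨hle, hK⟩
    · intro k hk
      rw [sat_gammaMatrix hA hX hD, Function.update_self]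
      rintro (h | ⟨-, h⟩)
      · exact hmin k hk (h.mono Set.subset_union_left)
      · exact hmin k hk h
  have hK2 : 2 < K :=
    lt_of_lt_of_le (by decide : 2 < zeroEqOne.code) hK.code_le
  have hlog := conjecture (group2 H) (group3 A X D) K K hgroup2 hbreak hK2 hK
  have hpos : 0 < Real.logb 2 K :=
    Real.logb_pos (by norm_num) (by exact_mod_cast (by omega : 1 < K))
  linarith
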